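/- Conventions. An equation over a group $G$ with unknown $t$ is a formal expression $w=g_1t^{\epsilon_1}\cdots g_nt^{\epsilon_n}=1$ with $g_i\in G$, $\epsilon_i\in\mathbb Z$. It is solvable over $G$ if some group $\widetilde G$ containing $G$ as a subgroup contains an element $\tilde t$ (a solution) with $g_1\tilde t^{\epsilon_1}\cdots g_n\tilde t^{\epsilon_n}=1$. It is unimodular if $\sum\epsilon_i=\pm1$. It is magnusian if it is solvable over $G$ and, for every free factor $H$ of $G$ such that $w$ is not conjugate in $G*\langle t\rangle_\infty$ to an element of $H*\langle t\rangle_\infty$, some group containing $G$ contains a solution $\tilde t$ that is transcendental over $H$, i.e. such that $\langle H,\tilde t\rangle=H*\langle\tilde t\rangle_\infty$. A generalized equation over $G$ with variable group $T$ is a formal expression $g_1t_1\cdots g_nt_n=1$ with $g_i\in G$, $t_i\in T$. It is solvable over $G$ if there are a group $\widetilde G$ containing $G$ as a subgroup and a homomorphism $T\to\widetilde G$, $t\mapsto\tilde t$, such that $g_1\tilde t_1\cdots g_n\tilde t_n=1$ in $\widetilde G$. It is unimodular if, for $s=t_1t_2\cdots t_n$, the element $s$ has infinite order in $T$, the subgroup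 $\langle s\rangle$ is normal in $T$, and $T/\langle s\rangle$ has the strong unique product property. A group $P$ has the strong unique product property if for any finite nonempty subsets $X,Y\subseteq P$ with $|Y|\ge2$ there are $x_1,x_2\in X$ and $y_1,y_2\in Y$ with $y_1\ne y_2$ such that each of the elements $x_1y_1$ and $x_2y_2$ decomposes uniquely as a product of an element of $X$ and an element of $Y$. A free power of $G$ is a free product of copies of $G$ indexed by an arbitrary set. Theorem. Let $G$ be a group such that every unimodular equation over every free power of $G$ is magnusian. Then every unimodular generalized equation over $G$, with any variable group $T$, is solvable over $G$. -/

import Mathlib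

universe u v w

namespace GroupEquation

open Monoid

/-- A formal expression `g₁ t ^ ε₁ g₂ t ^ ε₂ ⋯ gₙ t ^ εₙ = 1` over the group `G`, recorded as the
list of pairs `(gᵢ, εᵢ)`. -/
structure Equation (G : Type u) where
  /-- The syllables `(gᵢ, εᵢ)`. -/
  terms : List (G × ℤ)

/-- A formal expression `g₁ t₁ g₂ t₂ ⋯ gₙ tₙ = 1` over the group `G` with variable group `T`,
recorded as the list of pairs `(gᵢ, tᵢ)`. -/
structure GenEquation (G : Type u) (T : Type w) where
  /-- The syllables `(gᵢ, tᵢ)`. -/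
  terms : List (G × T)

/-- The subgroup `H` is a free factor of `G`: there is a subgroup `L` such that `G` is the
(internal) free product of `H` and `L`. -/
def IsFreeFactor {G : Type u} [Group G] (H : Subgroup G) : Prop :=
  ∃ L : Subgroup G, Function.Bijective (Coprod.lift H.subtype L.subtype)

/-- Let `f : G →* K` be an embedding. The element `t` of `K` is transcendental over `H ≤ G`:
the subgroup of `K` generated by `f H` and `t` is the free product of `f H` and the infinite
cyclic group generated by `t`, i.e. the natural map from the free product of `H` and an infinite
cyclic group to `K` is injective. -/
def IsTranscendentalOver {G : Type u} {K : Type v} [Group G] [Group K]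
    (f : G →* K) (H : Subgroup G) (t : K) : Prop :=
  Function.Injective (Coprod.lift (f.comp H.subtype) (zpowersHom K t))

/-- The strong unique product property: for finite nonempty `X`, `Y` with `|Y| ≥ 2` there are two
uniquely decomposable products `x₁ y₁`, `x₂ y₂` with `y₁ ≠ y₂`. -/
def StrongUniqueProduct (H : Type u) [Group H] : Prop :=
  ∀ X Y : Finset H, X.Nonempty → 2 ≤ Y.card →
    ∃ x₁ ∈ X, ∃ x₂ ∈ X, ∃ y₁ ∈ Y, ∃ y₂ ∈ Y,
      y₁ ≠ y₂ ∧ UniqueMul X Y x₁ y₁ ∧ UniqueMul X Y x₂ y₂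

/-- The free power of `G` with index set `ι`: the free product of copies of `G`, one for each
element of `ι`. -/
abbrev FreePower (G : Type u) [Group G] (ι : Type v) : Type (max v u) :=
  CoprodI (fun _ : ι => G)

namespace Equation

variable {G : Type u} [Group G]

/-- The left-hand side of the equation, as an element of the free product of `G` and the infinite
cyclic group generated by the unknown. -/
def word (e : Equation G) : Coprod G (Multiplicative ℤ) :=
  (e.terms.map fun p => Coprod.inl p.1 * Coprod.inr (Multiplicative.ofAdd p.2)).prod

/-- The sum of the exponents of the unknown. -/
def exponentSum (e : Equation G) : ℤ := (e.terms.map Prod.snd).sum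

/-- An equation is unimodular if its exponent sum is `1` or `-1`. -/
def IsUnimodular (e : Equation G) : Prop := e.exponentSum = 1 ∨ e.exponentSum = -1

/-- The element `t` of `K` is a solution, where `f : G →* K` is used to interpret the
coefficients. -/
def IsSolution {K : Type v} [Group K] (e : Equation G) (f : G →* K) (t : K) : Prop :=
  (e.terms.map fun p => f p.1 * t ^ p.2).prod = 1

/-- The equation has a solution in some overgroup of `G`. -/
def IsSolvable (e : Equation G) : Prop :=
  ∃ (K : Type u) (_ : Group K) (f : G →* K) (t : K),
    Function.Injective f ∧ e.IsSolution f t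

/-- The equation is an equation over the subgroup `H`: its left-hand side is conjugate, in the
free product of `G` and the infinite cyclic group, to an element of the free product of `H` and
that cyclic group. -/
def IsOver (e : Equation G) (H : Subgroup G) : Prop :=
  ∃ v : Coprod H (Multiplicative ℤ),
    IsConj e.word (Coprod.map H.subtype (MonoidHom.id (Multiplicative ℤ)) v)

/-- The equation is magnusian: it is solvable over `G` and, for each free factor `H` of `G` such
that it is not an equation over `H`, some overgroup of `G` contains a solution that is
transcendental over `H`. -/
def IsMagnusian (e : Equation G) : Prop :=
  e.IsSolvable ∧
    ∀ H : Subgroup G, IsFreeFactor H → ¬ e.IsOver H →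
      ∃ (K : Type u) (_ : Group K) (f : G →* K) (t : K),
        Function.Injective f ∧ e.IsSolution f t ∧ IsTranscendentalOver f H t

end Equation

namespace GenEquation

variable {G : Type u} {T : Type w} [Group G] [Group T]

/-- The product `t₁ t₂ ⋯ tₙ` in the variable group. -/
def varProd (e : GenEquation G T) : T := (e.terms.map Prod.snd).prod

/-- A generalized equation is unimodular if the product of the `tᵢ` has infinite order, generates
a normal subgroup of `T`, and the quotient of `T` by that subgroup has the strong unique product
property. -/
structure IsUnimodular (e : GenEquation G T) : Prop where
  infinite_order : ¬ IsOfFinOrder e.varProd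
  normal : (Subgroup.zpowers e.varProd).Normal
  strongUniqueProduct : StrongUniqueProduct (T ⧸ Subgroup.zpowers e.varProd)

/-- The homomorphism `φ : T →* K` is a solution, where `f : G →* K` is used to interpret the
coefficients. -/
def IsSolution {K : Type v} [Group K] (e : GenEquation G T) (f : G →* K) (φ : T →* K) : Prop :=
  (e.terms.map fun p => f p.1 * φ p.2).prod = 1

/-- The generalized equation has a solution in some overgroup of `G`. -/
def IsSolvable (e : GenEquation G T) : Prop :=
  ∃ (K : Type (max u w)) (_ : Group K) (f : G →* K) (φ : T →* K),
    Function.Injective f ∧ e.IsSolution f φ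

end GenEquation

end GroupEquation

/-! ### Free products of copies of `G` with an infinite cyclic group, and gluing of relators. -/

namespace GroupEquation

open Monoid

/-! Put `P = T ⧸ ⟨s⟩`. In the free product of `G` and `T`, the kernel of the map onto `P` is the
free product `M` of `⟨s⟩` and the conjugates of `G` by coset representatives, so it is `FreePowerVar
G P` with `s` as the unknown. Written as an element of `M`, the left-hand side of the generalized
equation becomes an ordinary word `r` of exponent sum 1 over a free power of `G`. It is enough to
kill all `T`-translates of `r` in `M` without killing elements of the copies of `G`: the quotient
still carries the action of `T`, and a semidirect product with `s` identified with the unknown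
(`exists_normal_subgroup_semidirectProduct`) contains a solution.

Replace `r` by a conjugate whose set `Y` of indices is minimal. Then for `y ∈ Y` the equation is not
over the other copies, and the magnusian property gives a Freiheitssatz: the normal closure of `r`
meets trivially the subgroup generated by the unknown and the copies in `Y \ {y}`
(`eq_one_of_mem_normalClosure_of_isMagnusian`). The translate by `x` involves only indices in `xY`.
For finitely many translates, a uniquely decomposable product `xy` is an index occurring in just one
of them, so adding that relator is an amalgamation (`normalClosure_union_amalgam`) and induction
applies (`normalClosure_image_finset`). -/

/-- The free product of a free power of `G` and the infinite cyclic group generated by an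
unknown. -/
abbrev FreePowerVar (G : Type u) [Group G] (ι : Type v) : Type (max v u) :=
  Coprod (FreePower G ι) (Multiplicative ℤ)

namespace FreePowerVar

variable {G : Type u} [Group G] {ι : Type v}

/-- The inclusion of the copy of `G` with index `i`. -/
def gen (i : ι) : G →* FreePowerVar G ι := Coprod.inl.comp (CoprodI.of (M := fun _ : ι => G) (i := i))

variable (G ι) in
/-- The unknown. -/
def unknown : FreePowerVar G ι := Coprod.inr (Multiplicative.ofAdd 1)

/-- The homomorphism with prescribed values on the copies of `G` and on the unknown. -/
def lift {L : Type w} [Group L] (f : ι → G →* L) (t : L) : FreePowerVar G ι →* L :=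
  Coprod.lift (CoprodI.lift f) (zpowersHom L t)

@[simp] theorem lift_gen {L : Type w} [Group L] (f : ι → G →* L) (t : L) (i : ι) (g : G) :
    lift f t (gen i g) = f i g := by
  simp [lift, gen]

@[simp] theorem lift_unknown {L : Type w} [Group L] (f : ι → G →* L) (t : L) :
    lift f t (unknown G ι) = t := by
  simp [lift, unknown]

theorem inr_eq_unknown_zpow (k : Multiplicative ℤ) :
    (Coprod.inr k : FreePowerVar G ι) = unknown G ι ^ k.toAdd := by
  rw [unknown, ← map_zpow, ← ofAdd_zsmul]
  simp

theorem hom_ext {L : Type w} [Group L] {f h : FreePowerVar G ι →* L}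
    (hgen : ∀ i g, f (gen i g) = h (gen i g)) (ht : f (unknown G ι) = h (unknown G ι)) :
    f = h := by
  refine Coprod.hom_ext (CoprodI.ext_hom _ _ fun i => MonoidHom.ext (hgen i)) ?_
  ext
  exact ht

/-- The subgroup generated by the unknown and the copies of `G` with index in `Z`. -/
def factor (G : Type u) [Group G] {ι : Type v} (Z : Set ι) : Subgroup (FreePowerVar G ι) :=
  Subgroup.closure ({m | ∃ z ∈ Z, ∃ g, gen z g = m} ∪ {unknown G ι})

theorem gen_mem_factor {Z : Set ι} {z : ι} (hz : z ∈ Z) (g : G) : gen z g ∈ factor G Z :=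
  Subgroup.subset_closure (Or.inl ⟨z, hz, g, rfl⟩)

theorem unknown_mem_factor (Z : Set ι) : unknown G ι ∈ factor G Z :=
  Subgroup.subset_closure (Or.inr rfl)

theorem factor_le_iff {Z : Set ι} {S : Subgroup (FreePowerVar G ι)} :
    factor G Z ≤ S ↔ (∀ z ∈ Z, ∀ g, gen z g ∈ S) ∧ unknown G ι ∈ S := by
  constructor
  · exact fun h => ⟨fun z hz g => h (gen_mem_factor hz g), h (unknown_mem_factor Z)⟩
  · rintro ⟨h₁, h₂⟩
    refine (Subgroup.closure_le S).2 ?_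
    rintro m (⟨z, hz, g, rfl⟩ | rfl)
    · exact h₁ z hz g
    · exact h₂

theorem factor_mono {Z Z' : Set ι} (h : Z ⊆ Z') : factor G Z ≤ factor G Z' :=
  factor_le_iff.2 ⟨fun _ hz g => gen_mem_factor (h hz) g, unknown_mem_factor Z'⟩

theorem map_mem_of_mem_factor {L : Type w} [Group L] (f : FreePowerVar G ι →* L)
    (S : Subgroup L) {Z : Set ι} (hgen : ∀ z ∈ Z, ∀ g, f (gen z g) ∈ S)
    (ht : f (unknown G ι) ∈ S) {m : FreePowerVar G ι} (hm : m ∈ factor G Z) : f m ∈ S :=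
  (factor_le_iff (S := S.comap f)).2 ⟨hgen, ht⟩ hm

theorem map_eq_of_mem_factor {L : Type w} [Group L] {f h : FreePowerVar G ι →* L} {Z : Set ι}
    (hgen : ∀ z ∈ Z, ∀ g, f (gen z g) = h (gen z g)) (ht : f (unknown G ι) = h (unknown G ι))
    {m : FreePowerVar G ι} (hm : m ∈ factor G Z) : f m = h m :=
  (factor_le_iff (S := f.eqLocus h)).2 ⟨hgen, ht⟩ hm

theorem exists_finset_mem_factor (m : FreePowerVar G ι) :
    ∃ Z : Finset ι, m ∈ factor G (Z : Set ι) := by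
  classical
  have mul : ∀ a b : FreePowerVar G ι, (∃ Z : Finset ι, a ∈ factor G (Z : Set ι)) →
      (∃ Z : Finset ι, b ∈ factor G (Z : Set ι)) →
      ∃ Z : Finset ι, a * b ∈ factor G (Z : Set ι) := by
    rintro a b ⟨Z, ha⟩ ⟨Z', hb⟩
    refine ⟨Z ∪ Z', mul_mem (factor_mono ?_ ha) (factor_mono ?_ hb)⟩ <;> simp
  induction m using Coprod.induction_on with
  | inl x =>
    induction x using CoprodI.induction_on with
    | one => exact ⟨∅, by rw [map_one]; exact one_mem _⟩
    | of i g => exact ⟨{i}, gen_mem_factor (by simp) g⟩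
    | mul a b ha hb => rw [map_mul]; exact mul _ _ ha hb
  | inr k => exact ⟨∅, by rw [inr_eq_unknown_zpow]; exact zpow_mem (unknown_mem_factor _) _⟩
  | mul a b ha hb => exact mul a b ha hb

/-- If two sets of relators, one not involving the index `z₀` and one involving besides `z₀` only
indices in `B`, both have normal closures that meet `factor G B` trivially, then imposing both of
them amounts to forming an amalgamated product over `factor G B`. -/
theorem normalClosure_union_amalgam {z₀ : ι} {B : Set ι} (hz₀ : z₀ ∉ B)
    {S₁ S₂ : Set (FreePowerVar G ι)} (hS₁ : S₁ ⊆ factor G ({z₀}ᶜ : Set ι))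
    (hS₂ : S₂ ⊆ factor G (insert z₀ B))
    (h₁ : ∀ m ∈ factor G B, m ∈ Subgroup.normalClosure S₁ → m = 1)
    (h₂ : ∀ m ∈ factor G B, m ∈ Subgroup.normalClosure S₂ → m = 1) :
    (∀ m ∈ factor G ({z₀}ᶜ : Set ι), m ∈ Subgroup.normalClosure (S₁ ∪ S₂) →
      m ∈ Subgroup.normalClosure S₁) ∧
    (∀ g, gen z₀ g ∈ Subgroup.normalClosure (S₁ ∪ S₂) →
      gen z₀ g ∈ Subgroup.normalClosure S₂) := by
  classical
  -- The value `true` labels the side of `S₁` and `false` that of `S₂`.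
  let S : Bool → Set (FreePowerVar G ι) := fun b => cond b S₁ S₂
  let φ : ∀ b, factor G B →* FreePowerVar G ι ⧸ Subgroup.normalClosure (S b) := fun b =>
    (QuotientGroup.mk' _).comp (factor G B).subtype
  have hφ : ∀ b, Function.Injective (φ b) := by
    intro b
    rw [injective_iff_map_eq_one]
    rintro ⟨m, hm⟩ hm1
    have hm2 : m ∈ Subgroup.normalClosure (S b) := (QuotientGroup.eq_one_iff _).1 hm1
    cases b
    · exact Subtype.ext (h₂ m hm hm2)
    · exact Subtype.ext (h₁ m hm hm2)
  let p : ∀ b, FreePowerVar G ι →* PushoutI φ := fun b =>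
    (PushoutI.of (φ := φ) b).comp (QuotientGroup.mk' _)
  have hp : ∀ b m, p b m = 1 → m ∈ Subgroup.normalClosure (S b) := fun b m hm =>
    (QuotientGroup.eq_one_iff _).1
      ((injective_iff_map_eq_one _).1 (PushoutI.of_injective hφ b) _ hm)
  have hp' : ∀ b, ∀ m ∈ S b, p b m = 1 := fun b m hm => by
    have : (QuotientGroup.mk' (Subgroup.normalClosure (S b))) m = 1 :=
      (QuotientGroup.eq_one_iff _).2 (Subgroup.subset_normalClosure hm)
    simp only [p, MonoidHom.comp_apply, this, map_one]
  have hpB : ∀ m ∈ factor G B, p true m = p false m := fun m hm =>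
    (PushoutI.of_apply_eq_base φ true ⟨m, hm⟩).trans
      (PushoutI.of_apply_eq_base φ false ⟨m, hm⟩).symm
  -- Only the copy `z₀` goes to the side of `S₂`. Indices in `B` may be sent to either side, because
  -- the two maps agree on the amalgamated subgroup; hence `Φ` kills both sets of relators.
  let Φ : FreePowerVar G ι →* PushoutI φ :=
    lift (fun z => (p (!decide (z = z₀))).comp (gen z)) (p true (unknown G ι))
  have hΦ₁ : ∀ m ∈ factor G ({z₀}ᶜ : Set ι), Φ m = p true m := fun m hm =>
    map_eq_of_mem_factor (fun z hz g => by
      have : z ≠ z₀ := hz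
      simp [Φ, this]) (by simp [Φ]) hm
  have hΦ₂ : ∀ m ∈ factor G (insert z₀ B), Φ m = p false m := fun m hm =>
    map_eq_of_mem_factor (fun z hz g => by
      rcases hz with rfl | hz
      · simp [Φ]
      · have : z ≠ z₀ := fun h => hz₀ (h ▸ hz)
        simp only [Φ, lift_gen, this, MonoidHom.comp_apply, decide_false, Bool.not_false]
        exact hpB _ (gen_mem_factor hz g))
      (by simpa [Φ] using hpB _ (unknown_mem_factor B)) hm
  have hker : Subgroup.normalClosure (S₁ ∪ S₂) ≤ Φ.ker := by
    refine Subgroup.normalClosure_le_normal ?_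
    rintro m (hm | hm)
    · exact (hΦ₁ m (hS₁ hm)).trans (hp' true m hm)
    · exact (hΦ₂ m (hS₂ hm)).trans (hp' false m hm)
  refine ⟨fun m hm hmR => hp true m ?_, fun g hmR => hp false _ ?_⟩
  · rw [← hΦ₁ m hm]; exact hker hmR
  · rw [← hΦ₂ _ (gen_mem_factor (Set.mem_insert z₀ B) g)]; exact hker hmR

end FreePowerVar

/-! ### Strong unique products and families of translated relators. -/

/-- The strong unique product property yields two uniquely decomposable products with different
left factors. -/
theorem StrongUniqueProduct.exists_left_ne {P : Type w} [Group P] (hP : StrongUniqueProduct P)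
    (X Y : Finset P) (hX : 2 ≤ X.card) (hY : Y.Nonempty) :
    ∃ x₁ ∈ X, ∃ x₂ ∈ X, ∃ y₁ ∈ Y, ∃ y₂ ∈ Y,
      x₁ ≠ x₂ ∧ UniqueMul X Y x₁ y₁ ∧ UniqueMul X Y x₂ y₂ := by
  classical
  -- Inversion reverses products, so distinct right factors for `Y⁻¹`, `X⁻¹` become distinct left
  -- factors for `X`, `Y`.
  obtain ⟨a, ha, b, hb, c, hc, d, hd, hcd, h₁, h₂⟩ :=
    hP (Y.image Inv.inv) (X.image Inv.inv) (hY.image _)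
      (by rwa [Finset.card_image_of_injective _ inv_injective])
  have key : ∀ p q : P, UniqueMul (Y.image Inv.inv) (X.image Inv.inv) p q →
      UniqueMul X Y q⁻¹ p⁻¹ := by
    intro p q h x y hx hy hxy
    have := h (Finset.mem_image_of_mem Inv.inv hy) (Finset.mem_image_of_mem Inv.inv hx)
      (by rw [← mul_inv_rev, hxy]; group)
    exact ⟨by rw [← this.2, inv_inv], by rw [← this.1, inv_inv]⟩
  have mem : ∀ (S : Finset P) (p : P), p ∈ S.image Inv.inv → p⁻¹ ∈ S := by
    intro S p hp
    obtain ⟨q, hq, rfl⟩ := Finset.mem_image.1 hp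
    rwa [inv_inv]
  exact ⟨c⁻¹, mem X c hc, d⁻¹, mem X d hd, a⁻¹, mem Y a ha, b⁻¹, mem Y b hb,
    fun h => hcd (inv_injective h), key _ _ h₁, key _ _ h₂⟩

namespace FreePowerVar

variable {G : Type u} [Group G] {P : Type w} [Group P]

/-- Translates of an equation: the induction on the finite set of translates. -/
theorem normalClosure_image_finset (hP : StrongUniqueProduct P) (Y : Finset P)
    (hY : Y.Nonempty) (r : P → FreePowerVar G P)
    (hr : ∀ x, r x ∈ factor G ((x * ·) '' (Y : Set P)))
    (hgen : ∀ x, ∀ y ∈ Y, ∀ g,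
      gen (x * y) g ∈ Subgroup.normalClosure {r x} → gen (x * y) g = 1)
    (hfac : ∀ x, ∀ y ∈ Y, ∀ m ∈ factor G ((x * ·) '' ((Y : Set P) \ {y})),
      m ∈ Subgroup.normalClosure {r x} → m = 1) (X : Finset P) :
    (∀ z g, gen z g ∈ Subgroup.normalClosure (r '' X) → gen z g = 1) ∧
    ∀ a ∉ X, ∀ m ∈ factor G ((a * ·) '' (Y : Set P)),
      m ∈ Subgroup.normalClosure (r '' X) → m = 1 := by
  classical
  induction hn : X.card generalizing X with
  | zero =>
    rw [Finset.card_eq_zero.1 hn]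
    simp
  | succ n ih =>
    -- By uniqueness the index `x * y` lies in no `x'Y` with `x' ∈ X` other than `x`, so `r x` is
    -- glued to the remaining relators along the indices `xY \ {xy}`.
    have step : ∀ x ∈ X, ∀ y ∈ Y, UniqueMul X Y x y →
        (∀ m ∈ factor G ({x * y}ᶜ : Set P), m ∈ Subgroup.normalClosure (r '' X) →
          m ∈ Subgroup.normalClosure (r '' (X.erase x : Finset P))) ∧
        (∀ g, gen (x * y) g ∈ Subgroup.normalClosure (r '' X) →
          gen (x * y) g ∈ Subgroup.normalClosure {r x}) := by
      intro x hx y hy hxy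
      have hXe : r '' X = r '' (X.erase x : Finset P) ∪ {r x} := by
        rw [← Set.image_singleton, ← Set.image_union]
        congr 1
        ext p
        by_cases h : p = x <;> simp [h, hx]
      have hB : (x * ·) '' (Y : Set P) ⊆ insert (x * y) ((x * ·) '' ((Y : Set P) \ {y})) := by
        rintro _ ⟨y', hy', rfl⟩
        by_cases h : y' = y
        · exact Or.inl (by rw [h])
        · exact Or.inr ⟨y', ⟨hy', h⟩, rfl⟩
      rw [hXe]
      refine normalClosure_union_amalgam (B := (x * ·) '' ((Y : Set P) \ {y})) ?_ ?_ ?_ ?_ ?_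
      · rintro ⟨y', ⟨_, hne⟩, h⟩
        exact hne (mul_left_cancel h)
      · rintro _ ⟨x', hx', rfl⟩
        refine factor_mono ?_ (hr x')
        rintro _ ⟨y', hy', rfl⟩ h
        exact (Finset.mem_erase.1 hx').1 (hxy (Finset.mem_erase.1 hx').2 hy' h).1
      · rintro _ rfl
        exact factor_mono hB (hr x)
      -- The second half of the induction statement exists for this: it applies to `x`, which is
      -- outside `X.erase x`.
      · intro m hm
        refine (ih (X.erase x) ?_).2 x (by simp) m
          (factor_mono (Set.image_mono Set.sdiff_subset) hm)
        rw [Finset.card_erase_of_mem hx, hn]; rfl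
      · exact hfac x y hy
    have hcard : ∀ x ∈ X, (X.erase x).card = n := fun x hx => by
      rw [Finset.card_erase_of_mem hx, hn]; rfl
    constructor
    · intro z g hz
      obtain ⟨x, hx, y, hy, hxy⟩ : ∃ x ∈ X, ∃ y ∈ Y, UniqueMul X Y x y := by
        by_cases h2 : 2 ≤ X.card
        · obtain ⟨x, hx, _, _, y, hy, _, _, _, h, _⟩ := hP.exists_left_ne X Y h2 hY
          exact ⟨x, hx, y, hy, h⟩
        · obtain ⟨x, rfl⟩ := Finset.card_eq_one.1 (by omega : X.card = 1)
          obtain ⟨y, hy⟩ := hY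
          refine ⟨x, by simp, y, hy, fun a b ha hb hab => ?_⟩
          rw [Finset.mem_singleton] at ha
          subst ha
          exact ⟨rfl, mul_left_cancel hab⟩
      obtain ⟨h₁, h₂⟩ := step x hx y hy hxy
      by_cases hzz : z = x * y
      · subst hzz
        exact hgen x y hy g (h₂ g hz)
      · exact (ih _ (hcard x hx)).1 z g (h₁ _ (gen_mem_factor hzz g) hz)
    · intro a ha m hm hmX
      have h2 : 2 ≤ (insert a X).card := by
        rw [Finset.card_insert_of_notMem ha]; omega
      -- Two unique products with different left factors are needed so that one avoids `a`.
      -- Uniqueness in `insert a X` then also keeps `x * y` out of `aY`, so `m` does not involve the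
      -- index being removed.
      obtain ⟨x, hxa, hx, y, hy, hxy⟩ : ∃ x, x ≠ a ∧ x ∈ insert a X ∧ ∃ y ∈ Y,
          UniqueMul (insert a X) Y x y := by
        obtain ⟨x₁, hx₁, x₂, hx₂, y₁, hy₁, y₂, hy₂, hne, h₁, h₂⟩ :=
          hP.exists_left_ne (insert a X) Y h2 hY
        by_cases h : x₁ = a
        · exact ⟨x₂, fun h' => hne (h.trans h'.symm), hx₂, y₂, hy₂, h₂⟩
        · exact ⟨x₁, h, hx₁, y₁, hy₁, h₁⟩
      have hxX : x ∈ X := Finset.mem_of_mem_insert_of_ne hx hxa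
      have hxy' : UniqueMul X Y x y := fun p q hp hq h => hxy (Finset.mem_insert_of_mem hp) hq h
      refine (ih _ (hcard x hxX)).2 a (fun h => ha (Finset.mem_of_mem_erase h)) m hm
        ((step x hxX y hy hxy').1 m (factor_mono ?_ hm) hmX)
      rintro _ ⟨y', hy', rfl⟩ h
      exact hxa (hxy (Finset.mem_insert_self a X) hy' h).1.symm

/-- The normal closure of all the relators is the directed union of those of finite subfamilies,
which reduces the claim to the finite case. -/
theorem gen_eq_one_of_mem_normalClosure_range (hP : StrongUniqueProduct P) (Y : Finset P)
    (hY : Y.Nonempty) (r : P → FreePowerVar G P)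
    (hr : ∀ x, r x ∈ factor G ((x * ·) '' (Y : Set P)))
    (hgen : ∀ x, ∀ y ∈ Y, ∀ g,
      gen (x * y) g ∈ Subgroup.normalClosure {r x} → gen (x * y) g = 1)
    (hfac : ∀ x, ∀ y ∈ Y, ∀ m ∈ factor G ((x * ·) '' ((Y : Set P) \ {y})),
      m ∈ Subgroup.normalClosure {r x} → m = 1) {z : P} {g : G}
    (h : gen z g ∈ Subgroup.normalClosure (Set.range r)) : gen z g = 1 := by
  classical
  have hdir : Directed (· ≤ ·) fun X : Finset P => Subgroup.normalClosure (r '' X) :=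
    (monotone_iff_forall_lt.2 fun X X' hX =>
      Subgroup.normalClosure_mono (Set.image_mono (by exact_mod_cast hX.le))).directed_le
  have hle : Subgroup.normalClosure (Set.range r) ≤
      ⨆ X : Finset P, Subgroup.normalClosure (r '' X) := by
    have : (⨆ X : Finset P, Subgroup.normalClosure (r '' X)).Normal :=
      inferInstance
    refine Subgroup.normalClosure_le_normal ?_
    rintro _ ⟨x, rfl⟩
    exact Subgroup.mem_iSup_of_mem {x} (Subgroup.subset_normalClosure ⟨x, by simp, rfl⟩)
  obtain ⟨X, hX⟩ := (Subgroup.mem_iSup_of_directed hdir).1 (hle h)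
  exact (normalClosure_image_finset hP Y hY r hr hgen hfac X).1 z g hX

end FreePowerVar

end GroupEquation

/-! ### A Freiheitssatz from the magnusian property. -/

namespace GroupEquation

open Monoid

theorem coprod_map_surjective {A B A' B' : Type*} [Group A] [Group B] [Group A'] [Group B']
    {f : A →* A'} {g : B →* B'} (hf : Function.Surjective f) (hg : Function.Surjective g) :
    Function.Surjective (Coprod.map f g) := by
  intro m
  induction m using Coprod.induction_on with
  | inl x => obtain ⟨a, rfl⟩ := hf x; exact ⟨Coprod.inl a, rfl⟩
  | inr x => obtain ⟨b, rfl⟩ := hg x; exact ⟨Coprod.inr b, rfl⟩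
  | mul x y hx hy =>
    obtain ⟨a, rfl⟩ := hx
    obtain ⟨b, rfl⟩ := hy
    exact ⟨a * b, map_mul _ _ _⟩

theorem isFreeFactor_range_of_bijective {A B F : Type*} [Group A] [Group B] [Group F]
    {j : A →* F} {k : B →* F} (h : Function.Bijective (Coprod.lift j k)) :
    IsFreeFactor j.range := by
  refine ⟨k.range, ?_⟩
  have hs : Function.Surjective (Coprod.map j.rangeRestrict k.rangeRestrict) :=
    coprod_map_surjective j.rangeRestrict_surjective k.rangeRestrict_surjective
  have hcomp : (Coprod.lift j.range.subtype k.range.subtype).comp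
      (Coprod.map j.rangeRestrict k.rangeRestrict) = Coprod.lift j k :=
    Coprod.hom_ext rfl rfl
  have hb : Function.Bijective (Coprod.lift j.range.subtype k.range.subtype ∘
      Coprod.map j.rangeRestrict k.rangeRestrict) := by
    rw [← MonoidHom.coe_comp, hcomp]; exact h
  constructor
  · intro a b hab
    obtain ⟨a, rfl⟩ := hs a
    obtain ⟨b, rfl⟩ := hs b
    exact congrArg _ (hb.1 hab)
  · exact Function.Surjective.of_comp hb.2

/-- The subgroup of a free power generated by all the copies but one. -/
def FreePower.compl (G : Type u) [Group G] {ι : Type v} (i : ι) : Subgroup (FreePower G ι) :=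
  (CoprodI.lift fun k : {k : ι // k ≠ i} => CoprodI.of (M := fun _ : ι => G) (i := k.1)).range

theorem FreePower.isFreeFactor_compl (G : Type u) [Group G] {ι : Type v} (i : ι) :
    IsFreeFactor (FreePower.compl G i) := by
  classical
  refine isFreeFactor_range_of_bijective (k := CoprodI.of (M := fun _ : ι => G) (i := i)) ?_
  let ψ : FreePower G ι →* Coprod (FreePower G {k : ι // k ≠ i}) G :=
    CoprodI.lift fun k => if h : k = i then Coprod.inr else
      Coprod.inl.comp (CoprodI.of (M := fun _ : {k : ι // k ≠ i} => G) (i := ⟨k, h⟩))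
  have h₁ : ψ.comp (Coprod.lift (CoprodI.lift fun k : {k : ι // k ≠ i} =>
      CoprodI.of (M := fun _ : ι => G) (i := k.1)) (CoprodI.of (M := fun _ : ι => G) (i := i))) = MonoidHom.id _ := by
    refine Coprod.hom_ext (CoprodI.ext_hom _ _ fun k => ?_) ?_
    · ext g; simp [ψ, k.2]
    · ext g; simp [ψ]
  have h₂ : (Coprod.lift (CoprodI.lift fun k : {k : ι // k ≠ i} =>
      CoprodI.of (M := fun _ : ι => G) (i := k.1)) (CoprodI.of (M := fun _ : ι => G) (i := i))).comp ψ = MonoidHom.id _ := by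
    refine CoprodI.ext_hom _ _ fun k => ?_
    ext g
    by_cases h : k = i
    · subst h; simp [ψ]
    · simp [ψ, h]
  exact Function.bijective_iff_has_inverse.2
    ⟨ψ, fun x => DFunLike.congr_fun h₁ x, fun x => DFunLike.congr_fun h₂ x⟩

namespace Equation

variable {A : Type u} [Group A]

theorem exists_word_eq (m : Coprod A (Multiplicative ℤ)) : ∃ e : Equation A, e.word = m := by
  induction m using Coprod.induction_on with
  | inl a => exact ⟨⟨[(a, 0)]⟩, by simp [word]⟩
  | inr k => exact ⟨⟨[(1, k.toAdd)]⟩, by simp [word]⟩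
  | mul x y hx hy =>
    obtain ⟨e, rfl⟩ := hx
    obtain ⟨e', rfl⟩ := hy
    exact ⟨⟨e.terms ++ e'.terms⟩, by simp [word]⟩

theorem snd_word (e : Equation A) :
    Coprod.snd e.word = Multiplicative.ofAdd e.exponentSum := by
  obtain ⟨l⟩ := e
  simp only [word, exponentSum]
  induction l with
  | nil => simp
  | cons p l ih => simp [ih]

theorem lift_word {K : Type v} [Group K] (e : Equation A) (f : A →* K) (t : K) :
    Coprod.lift f (zpowersHom K t) e.word = (e.terms.map fun p => f p.1 * t ^ p.2).prod := by
  obtain ⟨l⟩ := e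
  simp only [word]
  induction l with
  | nil => simp
  | cons p l ih => simp [ih]

end Equation

namespace FreePowerVar

variable {G : Type u} [Group G] {P : Type w}

/-- The homomorphism induced by a map of the index sets. -/
def reindex (G : Type u) [Group G] {ι : Type v} (σ : ι → P) :
    FreePowerVar G ι →* FreePowerVar G P :=
  lift (fun i => gen (σ i)) (unknown G P)

theorem range_reindex {ι : Type v} (σ : ι → P) :
    (reindex G σ).range = factor G (Set.range σ) := by
  apply le_antisymm
  · intro _ hm
    obtain ⟨m, rfl⟩ := hm
    obtain ⟨Z, hm⟩ := exists_finset_mem_factor m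
    refine map_mem_of_mem_factor _ _ (fun z _ g => ?_) ?_ hm
    · rw [reindex, lift_gen]; exact gen_mem_factor (Set.mem_range_self z) g
    · rw [reindex, lift_unknown]; exact unknown_mem_factor _
  · refine factor_le_iff.2 ⟨?_, MonoidHom.mem_range.2 ⟨unknown G ι, lift_unknown _ _⟩⟩
    rintro _ ⟨i, rfl⟩ g
    exact ⟨gen i g, lift_gen _ _ _ _⟩

/-- The free product of all copies of `G` but one with the infinite cyclic group, parametrized by
the subgroup `FreePower.compl`. -/
def toCompl (G : Type u) [Group G] {ι : Type v} (i : ι) :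
    FreePowerVar G {k : ι // k ≠ i} →* Coprod (FreePower.compl G i) (Multiplicative ℤ) :=
  Coprod.map (MonoidHom.rangeRestrict _) (MonoidHom.id _)

theorem toCompl_surjective {ι : Type v} (i : ι) : Function.Surjective (toCompl G i) :=
  coprod_map_surjective (MonoidHom.rangeRestrict_surjective _) Function.surjective_id

theorem map_subtype_comp_toCompl {ι : Type v} (i : ι) :
    (Coprod.map (FreePower.compl G i).subtype (MonoidHom.id (Multiplicative ℤ))).comp
      (toCompl G i) = reindex G Subtype.val := by
  refine hom_ext (fun k g => ?_) ?_
  · rw [reindex, lift_gen]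
    exact congrArg Coprod.inl (CoprodI.lift_of
      (fun k : {k : ι // k ≠ i} => CoprodI.of (M := fun _ : ι => G) (i := k.1)) g)
  · rw [reindex, lift_unknown]
    rfl

theorem snd_comp_reindex {ι : Type v} (σ : ι → P) :
    Coprod.snd.comp (reindex G σ) = Coprod.snd :=
  hom_ext (fun i g => by simp [reindex]; simp [gen]) (by simp [reindex]; simp [unknown])

theorem reindex_comp_reindex {ι : Type*} {κ : Type*} (σ : ι → P) (τ : κ → ι) :
    (reindex G σ).comp (reindex G τ) = reindex G (σ ∘ τ) :=
  hom_ext (fun i g => by simp [reindex]) (by simp [reindex])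

/-- A reduced unimodular equation that involves the index `y` has a normal closure meeting
trivially the copy of `G` with index `y` and the subgroup generated by the unknown and
the remaining copies. -/
theorem eq_one_of_mem_normalClosure_of_isMagnusian
    (hG : ∀ (ι : Type v) (e : Equation (FreePower G ι)), e.IsUnimodular → e.IsMagnusian)
    (Y : Finset P) {r : FreePowerVar G P} (hr : r ∈ factor G (Y : Set P))
    (hexp : Coprod.snd r = Multiplicative.ofAdd 1) {y : P} (hy : y ∈ Y)
    (hconj : ∀ m ∈ factor G ((Y : Set P) \ {y}), ¬ IsConj r m) :
    (∀ g, gen y g ∈ Subgroup.normalClosure {r} → g = 1) ∧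
    ∀ m ∈ factor G ((Y : Set P) \ {y}), m ∈ Subgroup.normalClosure {r} → m = 1 := by
  classical
  -- The hypothesis concerns index types in universe `v`, while `P` lives in `w`; finiteness of `Y`
  -- allows reindexing.
  let ι := ULift.{v} (Fin Y.card)
  let σ : ι ≃ Y := Equiv.ulift.trans Y.equivFin.symm
  let τ : ι → P := fun i => σ i
  have hτ : Set.range τ = Y := by
    ext z
    exact ⟨fun ⟨i, hi⟩ => hi ▸ (σ i).2, fun hz => ⟨σ.symm ⟨z, hz⟩, by simp [τ]⟩⟩
  obtain ⟨i, hi⟩ : y ∈ Set.range τ := hτ ▸ hy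
  have hτinj : Function.Injective τ := Subtype.val_injective.comp σ.injective
  have hτi : Set.range (τ ∘ (Subtype.val : {k // k ≠ i} → ι)) = (Y : Set P) \ {y} := by
    ext z
    rw [← hτ, ← hi]
    constructor
    · rintro ⟨k, rfl⟩
      exact ⟨⟨k, rfl⟩, fun h => k.2 (hτinj h)⟩
    · rintro ⟨⟨k, rfl⟩, hk⟩
      exact ⟨⟨k, fun h => hk (congrArg τ h)⟩, rfl⟩
  rw [← hτ, ← range_reindex] at hr
  rw [← hτi, ← range_reindex, ← reindex_comp_reindex, ← map_subtype_comp_toCompl] at hconj ⊢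
  obtain ⟨m₀, hm₀⟩ := hr
  obtain ⟨e, rfl⟩ := Equation.exists_word_eq m₀
  have hexp' : e.exponentSum = 1 := by
    have := e.snd_word
    rw [← snd_comp_reindex τ, MonoidHom.comp_apply, hm₀, hexp] at this
    exact (Multiplicative.ofAdd.injective this).symm
  -- A conjugate of the word avoiding the index `i` would map to a conjugate of `r` avoiding `y`.
  have hover : ¬ e.IsOver (FreePower.compl G i) := by
    rintro ⟨c, hc⟩
    obtain ⟨c, rfl⟩ := toCompl_surjective i c
    refine hconj _ ⟨c, rfl⟩ ?_
    rw [← hm₀]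
    exact (reindex G τ).map_isConj hc
  obtain ⟨K, _, f, t, hf, hsol, htr⟩ :=
    (hG _ e (Or.inl hexp')).2 _ (FreePower.isFreeFactor_compl G i) hover
  -- Evaluation at the transcendental solution. The value 1 on copies outside `Y` is arbitrary,
  -- since `r` does not involve them.
  let ρ : FreePowerVar G P →* K := lift (fun z => if h : z ∈ Y then
    f.comp (CoprodI.of (M := fun _ => G) (i := σ.symm ⟨z, h⟩)) else 1) t
  have hρτ : ∀ k g, ρ (gen (τ k) g) = f (CoprodI.of (M := fun _ => G) (i := k) g) := by
    intro k g
    simp [ρ, τ]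
  have hρJ : ρ.comp (reindex G τ) = Coprod.lift f (zpowersHom K t) :=
    hom_ext (fun k g => by
        rw [MonoidHom.comp_apply, reindex, lift_gen, hρτ]; rfl)
      (by
        rw [MonoidHom.comp_apply, reindex, lift_unknown, lift_unknown]
        exact (zpow_one t).symm)
  have hker : Subgroup.normalClosure {r} ≤ ρ.ker := by
    refine Subgroup.normalClosure_le_normal ?_
    rw [Set.singleton_subset_iff]
    change ρ r = 1
    rw [← hm₀, ← MonoidHom.comp_apply, hρJ, Equation.lift_word]
    exact hsol
  constructor
  · intro g hg
    have h1 : ρ (gen y g) = 1 := hker hg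
    rw [← hi, hρτ] at h1
    exact (injective_iff_map_eq_one _).1 (CoprodI.of_injective (M := fun _ => G) i) _
      ((injective_iff_map_eq_one _).1 hf _ h1)
  · rintro _ ⟨c, rfl⟩ hmr
    have h1 : ρ (reindex G τ _) = 1 := hker hmr
    rw [← MonoidHom.comp_apply, hρJ] at h1
    have h2 : (Coprod.lift f (zpowersHom K t)).comp (Coprod.map (FreePower.compl G i).subtype
        (MonoidHom.id (Multiplicative ℤ))) =
        Coprod.lift (f.comp (FreePower.compl G i).subtype) (zpowersHom K t) :=
      Coprod.hom_ext rfl rfl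
    rw [MonoidHom.comp_apply, ← MonoidHom.comp_apply, h2] at h1
    rw [MonoidHom.comp_apply, MonoidHom.comp_apply, (injective_iff_map_eq_one _).1 htr _ h1,
      map_one, map_one]

end FreePowerVar

end GroupEquation

/-! ### The action of the variable group on the free product. -/

namespace GroupEquation

open Monoid

namespace FreePowerVar

variable {G : Type u} [Group G] {T : Type w} [Group T] (s : T) [(Subgroup.zpowers s).Normal]

theorem exists_mul_out_eq (t : T) (x : T ⧸ Subgroup.zpowers s) :
    ∃ k : ℤ, t * x.out = s ^ k * ((t : T ⧸ Subgroup.zpowers s) * x).out := by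
  have h : ((t * x.out : T) : T ⧸ Subgroup.zpowers s) =
      (((t : T ⧸ Subgroup.zpowers s) * x).out : T) := by
    rw [QuotientGroup.mk_mul, QuotientGroup.out_eq', QuotientGroup.out_eq']
  obtain ⟨k, hk⟩ := (QuotientGroup.eq_iff_div_mem.1 h :)
  exact ⟨k, eq_mul_of_div_eq hk.symm⟩

theorem exists_conj_eq_zpow (t : T) : ∃ k : ℤ, t * s * t⁻¹ = s ^ k := by
  obtain ⟨k, hk⟩ := Subgroup.Normal.conj_mem (H := Subgroup.zpowers s) inferInstance s
    (Subgroup.mem_zpowers s) t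
  exact ⟨k, hk.symm⟩

/-- The cocycle describing the translation of coset representatives by `t`. -/
noncomputable def shift (t : T) (x : T ⧸ Subgroup.zpowers s) : ℤ := (exists_mul_out_eq s t x).choose

theorem mul_out_eq (t : T) (x : T ⧸ Subgroup.zpowers s) :
    t * x.out = s ^ shift s t x * ((t : T ⧸ Subgroup.zpowers s) * x).out :=
  (exists_mul_out_eq s t x).choose_spec

/-- The exponent describing the conjugation of `s` by `t`. -/
noncomputable def conjExp (t : T) : ℤ := (exists_conj_eq_zpow s t).choose

theorem conj_eq_zpow (t : T) : t * s * t⁻¹ = s ^ conjExp s t :=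
  (exists_conj_eq_zpow s t).choose_spec

theorem mul_zpow_eq (t : T) (k : ℤ) : t * s ^ k = s ^ (conjExp s t * k) * t := by
  rw [zpow_mul, ← conj_eq_zpow, conj_zpow]
  group

/-- The endomorphism by which an element of `T` acts: in the free product of `G` and `T`, the
subgroup generated by `s` and the conjugates of `G` by coset representatives of `s` is
invariant under conjugation. -/
noncomputable def act (G : Type u) [Group G] (t : T) :
    FreePowerVar G (T ⧸ Subgroup.zpowers s) →* FreePowerVar G (T ⧸ Subgroup.zpowers s) :=
  lift (fun x => (MulAut.conj (unknown G _ ^ shift s t x)).toMonoidHom.comp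
    (gen ((t : T ⧸ Subgroup.zpowers s) * x))) (unknown G _ ^ conjExp s t)

@[simp] theorem act_gen (t : T) (x : T ⧸ Subgroup.zpowers s) (g : G) :
    act s G t (gen x g) = unknown G _ ^ shift s t x *
      gen ((t : T ⧸ Subgroup.zpowers s) * x) g * (unknown G _ ^ shift s t x)⁻¹ := by
  rw [act, lift_gen]
  rfl

@[simp] theorem act_unknown (t : T) :
    act s G t (unknown G _) = unknown G _ ^ conjExp s t := by
  simp [act]

theorem act_mem_factor (t : T) {Z : Set (T ⧸ Subgroup.zpowers s)}
    {m : FreePowerVar G (T ⧸ Subgroup.zpowers s)} (hm : m ∈ factor G Z) :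
    act s G t m ∈ factor G (((t : T ⧸ Subgroup.zpowers s) * ·) '' Z) := by
  refine map_mem_of_mem_factor _ _ (fun z hz g => ?_) ?_ hm
  · rw [act_gen]
    exact mul_mem (mul_mem (zpow_mem (unknown_mem_factor _) _) (gen_mem_factor (Set.mem_image_of_mem _ hz) g))
      (inv_mem (zpow_mem (unknown_mem_factor _) _))
  · rw [act_unknown]
    exact zpow_mem (unknown_mem_factor _) _

theorem act_mem_normalClosure (t : T) {S : Set (FreePowerVar G (T ⧸ Subgroup.zpowers s))}
    {m : FreePowerVar G (T ⧸ Subgroup.zpowers s)} (hm : m ∈ Subgroup.normalClosure S) :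
    act s G t m ∈ Subgroup.normalClosure (act s G t '' S) :=
  Subgroup.map_normalClosure_le S (act s G t) ⟨m, hm, rfl⟩

/-- Consequently words of exponent sum zero form an invariant subgroup, which later fixes the
exponent sum of the relator. -/
theorem snd_act (t : T) (m : FreePowerVar G (T ⧸ Subgroup.zpowers s)) :
    Coprod.snd (act s G t m) = Coprod.snd m ^ conjExp s t := by
  have : Coprod.snd.comp (act s G t) = (zpowGroupHom (conjExp s t)).comp Coprod.snd :=
    hom_ext (fun x g => by simp; simp [gen]) (by simp)
  exact DFunLike.congr_fun this m

variable {s} (hs : ¬ IsOfFinOrder s)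
include hs

theorem act_one : act s G 1 = MonoidHom.id _ := by
  have hinj := injective_zpow_iff_not_isOfFinOrder.2 hs
  have h₁ : conjExp s 1 = 1 := hinj (by
    have := conj_eq_zpow s 1
    simpa using this.symm)
  have h₂ : ∀ x, shift s 1 x = 0 := fun x => hinj (by
    have := mul_out_eq s 1 x
    simpa using this)
  exact hom_ext (fun x g => by simp [h₂]) (by simp [h₁])

theorem act_mul (t t' : T) : act s G (t * t') = (act s G t).comp (act s G t') := by
  have hinj := injective_zpow_iff_not_isOfFinOrder.2 hs
  have h₁ : conjExp s (t * t') = conjExp s t * conjExp s t' := hinj (by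
    have := mul_zpow_eq s t (conjExp s t')
    rw [← conj_eq_zpow s t'] at this
    change s ^ _ = s ^ _
    rw [← conj_eq_zpow s (t * t'), ← mul_inv_eq_iff_eq_mul.2 this]
    group)
  -- The twisted cocycle identity: move `t'` and then `t` past the representative and compare
  -- exponents, which are determined because `s` has infinite order.
  have h₂ : ∀ x, shift s (t * t') x =
      conjExp s t * shift s t' x + shift s t (t' * x) := fun x => hinj (by
    have h := mul_out_eq s (t * t') x
    rw [mul_assoc, mul_out_eq s t' x, ← mul_assoc, mul_zpow_eq, mul_assoc, mul_out_eq s t,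
      ← mul_assoc, ← mul_assoc, ← zpow_add, QuotientGroup.mk_mul] at h
    exact (mul_right_cancel h).symm)
  refine hom_ext (fun x g => ?_) ?_
  · simp only [act_gen, h₂, MonoidHom.comp_apply, map_mul, map_zpow, map_inv, act_unknown,
      QuotientGroup.mk_mul, zpow_add, zpow_mul]
    simp only [mul_assoc, mul_inv_rev]
  · simp [h₁, zpow_mul]

/-- The action of `T`. -/
noncomputable def actHom (G : Type u) [Group G] : T →* MulAut (FreePowerVar G (T ⧸ Subgroup.zpowers s)) where
  toFun t := MonoidHom.toMulEquiv (act s G t) (act s G t⁻¹)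
    (by rw [← act_mul hs, inv_mul_cancel, act_one hs])
    (by rw [← act_mul hs, mul_inv_cancel, act_one hs])
  map_one' := MulEquiv.ext fun m => DFunLike.congr_fun (act_one hs) m
  map_mul' t t' := MulEquiv.ext fun m => DFunLike.congr_fun (act_mul hs t t') m

@[simp] theorem actHom_apply (t : T) (m : FreePowerVar G (T ⧸ Subgroup.zpowers s)) :
    actHom hs G t m = act s G t m := rfl

/-- Powers of `s` fix every coset and commute with `s`, so only the shift by `k` remains. As the
action is inner, the translates of a relator by elements of one coset are conjugate. -/
theorem act_zpow (k : ℤ) :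
    act s G (s ^ k) = (MulAut.conj (unknown G (T ⧸ Subgroup.zpowers s) ^ k)).toMonoidHom := by
  have hinj := injective_zpow_iff_not_isOfFinOrder.2 hs
  have hmk : ((s ^ k : T) : T ⧸ Subgroup.zpowers s) = 1 :=
    (QuotientGroup.eq_one_iff _).2 ⟨k, rfl⟩
  have h₁ : conjExp s (s ^ k) = 1 := hinj (by
    have := conj_eq_zpow s (s ^ k)
    change s ^ _ = s ^ _
    rw [← this]
    group)
  have h₂ : ∀ x, shift s (s ^ k) x = k := fun x => hinj (by
    have := mul_out_eq s (s ^ k) x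
    rw [hmk, one_mul] at this
    exact (mul_right_cancel this).symm)
  refine hom_ext (fun x g => ?_) ?_
  · rw [act_gen, h₂, hmk, one_mul]
    rfl
  · simp only [act_unknown, h₁, MulEquiv.coe_toMonoidHom, MulAut.conj_apply]
    group

theorem act_inv_act (t : T) (m : FreePowerVar G (T ⧸ Subgroup.zpowers s)) :
    act s G t⁻¹ (act s G t m) = m := by
  rw [← MonoidHom.comp_apply, ← act_mul hs, inv_mul_cancel, act_one hs, MonoidHom.id_apply]

theorem mem_normalClosure_of_act_mem (t : T) {r m : FreePowerVar G (T ⧸ Subgroup.zpowers s)}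
    (h : act s G t m ∈ Subgroup.normalClosure {act s G t r}) :
    m ∈ Subgroup.normalClosure {r} := by
  have := act_mem_normalClosure s t⁻¹ h
  rwa [Set.image_singleton, act_inv_act hs, act_inv_act hs] at this

/-- Imposing all translates of a unimodular equation keeps the copies of `G` embedded. -/
theorem eq_one_of_gen_mem_normalClosure_range_act
    (hG : ∀ (ι : Type v) (e : Equation (FreePower G ι)), e.IsUnimodular → e.IsMagnusian)
    (hP : StrongUniqueProduct (T ⧸ Subgroup.zpowers s))
    {r₀ : FreePowerVar G (T ⧸ Subgroup.zpowers s)}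
    (hexp : Coprod.snd r₀ = Multiplicative.ofAdd 1) {z : T ⧸ Subgroup.zpowers s} {g : G}
    (h : gen z g ∈ Subgroup.normalClosure (Set.range fun t => act s G t r₀)) : g = 1 := by
  classical
  -- Minimality of `Y` over all conjugates of `r₀` is what excludes equations over a smaller set of
  -- copies.
  obtain ⟨Y, ⟨r, hr, hrr⟩, hmin⟩ := exists_minimal_of_wellFoundedLT
    (fun Y : Finset (T ⧸ Subgroup.zpowers s) =>
      ∃ r ∈ factor G (Y : Set (T ⧸ Subgroup.zpowers s)), IsConj r₀ r)
    (let ⟨Y, hY⟩ := exists_finset_mem_factor r₀; ⟨Y, r₀, hY, IsConj.refl _⟩)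
  rcases Y.eq_empty_or_nonempty with rfl | hY
  -- With no indices, `r` is a power of the unknown, so every translate dies in the projection to
  -- the free power, which is injective on each copy of `G`.
  · have hle : Subgroup.normalClosure (Set.range fun t => act s G t r₀) ≤
        (Coprod.fst : FreePowerVar G (T ⧸ Subgroup.zpowers s) →* _).ker := by
      refine Subgroup.normalClosure_le_normal ?_
      rintro _ ⟨t, rfl⟩
      have h₁ := act_mem_factor s t hr
      have h₂ : Coprod.fst (act s G t r) = 1 := by
        refine map_eq_of_mem_factor (f := Coprod.fst) (h := 1) (fun z hz => ?_) rfl h₁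
        simp at hz
      have h₃ := (Coprod.fst.comp (act s G t)).map_isConj hrr
      rw [MonoidHom.comp_apply, MonoidHom.comp_apply, h₂, isConj_one_left] at h₃
      exact h₃
    have : CoprodI.of (M := fun _ => G) (i := z) g = 1 := hle h
    exact (injective_iff_map_eq_one _).1 (CoprodI.of_injective (M := fun _ => G) z) _ this
  have hexp' : Coprod.snd r = Multiplicative.ofAdd 1 := by
    rw [← hexp]
    exact (isConj_iff_eq.1 (Coprod.snd.map_isConj hrr)).symm
  have hprop := fun {y} (hy : y ∈ Y) => eq_one_of_mem_normalClosure_of_isMagnusian hG Y hr hexp' hy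
    fun m hm hc => (Finset.erase_ssubset hy).2 (hmin (y := Y.erase y)
      ⟨m, by rwa [Finset.coe_erase], hrr.trans hc⟩ (Finset.erase_subset _ _))
  have hgenz : gen z g = 1 := by
    refine gen_eq_one_of_mem_normalClosure_range hP Y hY (fun x => act s G x.out r) ?_ ?_ ?_ ?_
    · intro x
      have := act_mem_factor s x.out hr
      rwa [QuotientGroup.out_eq'] at this
    · intro x y hy g hg
      -- The action carries the copy `y` to the copy `x * y` only up to conjugation by a power of
      -- the unknown, which a normal subgroup does not see.
      have hconj : act s G x.out (gen y g) ∈ Subgroup.normalClosure {act s G x.out r} := by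
        rw [act_gen, QuotientGroup.out_eq']
        exact Subgroup.normalClosure_normal.conj_mem _ hg _
      rw [(hprop hy).1 g (mem_normalClosure_of_act_mem hs _ hconj), map_one]
    · intro x y hy m hm hmr
      have h₁ := act_mem_factor s x.out⁻¹ hm
      have h₂ := act_inv_act (G := G) hs x.out⁻¹ m
      rw [inv_inv] at h₂
      have h₃ : act s G x.out⁻¹ m = 1 := by
        refine (hprop hy).2 _ ?_ (mem_normalClosure_of_act_mem hs x.out (by rwa [h₂]))
        rw [QuotientGroup.mk_inv, QuotientGroup.out_eq', Set.image_image] at h₁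
        simpa using h₁
      rw [← h₂, h₃, map_one]
    -- One representative per coset suffices: any `t` is `s ^ k * x.out`, and both the action of `s
    -- ^ k` and the passage from `r` to `r₀` are conjugations.
    · refine Subgroup.normalClosure_le_normal ?_ h
      rintro _ ⟨t, rfl⟩
      let x : T ⧸ Subgroup.zpowers s := QuotientGroup.mk t
      obtain ⟨k, hk⟩ : ∃ k : ℤ, t = s ^ k * x.out := by
        obtain ⟨k, hk⟩ := (QuotientGroup.eq_iff_div_mem.1
          (QuotientGroup.out_eq' x).symm :)
        exact ⟨k, eq_mul_of_div_eq hk.symm⟩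
      have h₁ : act s G x.out r ∈ Subgroup.normalClosure
          (Set.range fun x : T ⧸ Subgroup.zpowers s => act s G x.out r) :=
        Subgroup.subset_normalClosure ⟨x, rfl⟩
      obtain ⟨c, hc⟩ := isConj_iff.1 hrr.symm
      change act s G t r₀ ∈ _
      rw [hk, act_mul hs, act_zpow hs, ← hc, MonoidHom.comp_apply,
        map_mul (act s G x.out), map_mul (act s G x.out), map_inv (act s G x.out)]
      exact Subgroup.normalClosure_normal.conj_mem _
        (Subgroup.normalClosure_normal.conj_mem _ h₁ _) _
  exact (injective_iff_map_eq_one _).1 (CoprodI.of_injective (M := fun _ => G) z) _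
    (congrArg Coprod.fst hgenz)

end FreePowerVar

end GroupEquation

/-! ### Identifying the unknown with `s` in a semidirect product, and the conclusion. -/

namespace GroupEquation

/-- In the semidirect product of `M / R` by `T`, the element `x` of `M` and the element `s` of `T`
of infinite order that act in the same way can be identified. -/
theorem exists_normal_subgroup_semidirectProduct {M T : Type*} [Group M] [Group T]
    (α : T →* MulAut M) (x : M) {s : T} (hs : ¬ IsOfFinOrder s)
    (hconj : ∀ t, ∃ k : ℤ, t * s * t⁻¹ = s ^ k ∧ α t x = x ^ k)
    (hαs : ∀ m, α s m = x * m * x⁻¹) (R : Subgroup M) [hRn : R.Normal]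
    (hR : ∀ t, ∀ m ∈ R, α t m ∈ R) :
    ∃ E : Subgroup (M ⋊[α] T), E.Normal ∧
      (∀ m, (SemidirectProduct.inl m : M ⋊[α] T) ∈ E ↔ m ∈ R) ∧
      SemidirectProduct.inl x⁻¹ * SemidirectProduct.inr s ∈ E := by
  -- Since `x` and `s` induce the same automorphism of `M`, this element centralizes `M`;
  -- conjugation by `T` sends it to its powers. So it generates a normal subgroup.
  let d : M ⋊[α] T := SemidirectProduct.inl x⁻¹ * SemidirectProduct.inr s
  have hnR : (R.map (SemidirectProduct.inl : M →* M ⋊[α] T)).Normal := by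
    refine ⟨?_⟩
    rintro _ ⟨m, hm, rfl⟩ a
    refine ⟨a.left * α a.right m * a.left⁻¹, hRn.conj_mem _ (hR _ _ hm) _, ?_⟩
    ext <;> simp [mul_assoc]
  have hdM : ∀ m, Commute d (SemidirectProduct.inl m) := by
    intro m
    ext <;> simp [d, hαs, mul_assoc]
  have hnd : (Subgroup.zpowers d).Normal := by
    refine ⟨?_⟩
    rintro _ ⟨n, rfl⟩ a
    obtain ⟨k, hk₁, hk₂⟩ := hconj a.right
    have hc : Commute (SemidirectProduct.inl x⁻¹ : M ⋊[α] T) (SemidirectProduct.inr s) := by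
      ext <;> simp [hαs]
    have hd : ∀ k : ℤ, d ^ k =
        SemidirectProduct.inl (x ^ k)⁻¹ * SemidirectProduct.inr (s ^ k) := by
      intro k
      rw [hc.mul_zpow, ← map_zpow, ← map_zpow, inv_zpow]
    have h₁ : SemidirectProduct.inr a.right * d * (SemidirectProduct.inr a.right)⁻¹ = d ^ k := by
      rw [hd, ← hk₁, ← hk₂, ← map_inv (α a.right), SemidirectProduct.inl_aut]
      simp [d, mul_assoc]
    refine ⟨k * n, ?_⟩
    change d ^ (k * n) = a * d ^ n * a⁻¹
    rw [← SemidirectProduct.inl_left_mul_inr_right a, ← conj_zpow, mul_inv_rev, zpow_mul, ← h₁]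
    have h₂ := (hdM a.left).zpow_left k
    rw [← h₁] at h₂
    congr 1
    refine (mul_inv_cancel_right _ (SemidirectProduct.inl a.left)).symm.trans ?_
    rw [h₂.eq]
    simp only [mul_assoc]
  refine ⟨R.map (SemidirectProduct.inl : M →* M ⋊[α] T) ⊔ Subgroup.zpowers d, inferInstance,
    fun m => ⟨fun hm => ?_, fun hm => Subgroup.mem_sup_left ⟨m, hm, rfl⟩⟩,
    Subgroup.mem_sup_right (Subgroup.mem_zpowers d)⟩
  obtain ⟨_, ⟨m', hm', rfl⟩, _, ⟨k, rfl⟩, h⟩ := Subgroup.mem_sup_of_normal_left.1 hm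
  change SemidirectProduct.inl m' * d ^ k = _ at h
  -- Projection to `T` turns `d ^ k` into `s ^ k`, so infinite order of `s` prevents `d` from adding
  -- relations in `M`.
  have hk : k = 0 := by
    have := congrArg SemidirectProduct.rightHom h
    have hd : SemidirectProduct.rightHom d = s := by simp [d]
    rw [map_mul, map_zpow, hd] at this
    refine injective_zpow_iff_not_isOfFinOrder.2 hs ?_
    simpa using this
  rw [hk, zpow_zero, mul_one, SemidirectProduct.inl_inj] at h
  exact h ▸ hm'

end GroupEquation

open GroupEquation Monoid FreePowerVar in
theorem mainTheorem3 (G : Type u) [Group G]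
    (hG : ∀ (ι : Type v) (e : GroupEquation.Equation (GroupEquation.FreePower G ι)),
      e.IsUnimodular → e.IsMagnusian)
    (T : Type w) [Group T] (e : GroupEquation.GenEquation G T) (he : e.IsUnimodular) :
    e.IsSolvable := by
  obtain ⟨hs, hn, hP⟩ := he
  set s := e.varProd
  let M := FreePowerVar G (T ⧸ Subgroup.zpowers s)
  let α := actHom hs G
  let x : M := unknown G _
  -- The coefficients lie in the copy with index 1; moving the `tᵢ` to the right spreads them over
  -- the other copies.
  let Q : List (G × T) → M ⋊[α] T := fun l => (l.map fun p =>
    SemidirectProduct.inl (gen 1 p.1) * SemidirectProduct.inr p.2).prod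
  have hQ : ∀ l, (Q l).right = (l.map Prod.snd).prod ∧ Coprod.snd (Q l).left = 1 := by
    intro l
    induction l with
    | nil => simp [Q]
    | cons p l ih =>
      have hQl : Q (p :: l) = SemidirectProduct.inl (gen 1 p.1) * SemidirectProduct.inr p.2 * Q l :=
        List.prod_cons
      rw [hQl, List.map_cons, List.prod_cons]
      refine ⟨by rw [SemidirectProduct.mul_right, ih.1]; simp, ?_⟩
      rw [SemidirectProduct.mul_left, map_mul, actHom_apply, snd_act, ih.2, one_zpow]
      simp [gen]
  let q := Q e.terms
  have hq : q.right = s ∧ Coprod.snd q.left = 1 := hQ e.terms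
  -- The final `s` of `q` is replaced by the unknown, so `q` is `r` times the element `x⁻¹ s` of
  -- `E`, and killing `r` kills `q`.
  let r := q.left * x
  have hr : Coprod.snd r = Multiplicative.ofAdd 1 := by
    simp only [r, map_mul, hq.2, one_mul]
    rfl
  let R : Subgroup M := Subgroup.normalClosure (Set.range fun t => act s G t r)
  have hR : ∀ t, ∀ m ∈ R, α t m ∈ R := by
    intro t m hm
    refine Subgroup.normalClosure_mono ?_ (act_mem_normalClosure s t hm)
    rintro _ ⟨_, ⟨t', rfl⟩, rfl⟩
    exact ⟨t * t', by simp only [act_mul hs, MonoidHom.comp_apply]⟩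
  have hαs : ∀ m : M, α s m = x * m * x⁻¹ := fun m => by
    have := act_zpow (G := G) hs 1
    rw [zpow_one, zpow_one] at this
    exact DFunLike.congr_fun this m
  obtain ⟨E, _, hER, hdE⟩ := exists_normal_subgroup_semidirectProduct α x hs
    (fun t => ⟨conjExp s t, conj_eq_zpow s t, act_unknown s t⟩) hαs R hR
  refine ⟨(M ⋊[α] T) ⧸ E, inferInstance,
    ((QuotientGroup.mk' E).comp SemidirectProduct.inl).comp (gen 1),
    (QuotientGroup.mk' E).comp SemidirectProduct.inr, ?_, ?_⟩
  · rw [injective_iff_map_eq_one]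
    intro g hg
    exact eq_one_of_gen_mem_normalClosure_range_act hs hG hP hr
      ((hER _).1 ((QuotientGroup.eq_one_iff _).1 hg))
  · have hqE : q ∈ E := by
      have hrE : (SemidirectProduct.inl r : M ⋊[α] T) ∈ E :=
        (hER r).2 (Subgroup.subset_normalClosure ⟨1, by simp [act_one hs]⟩)
      have : q = SemidirectProduct.inl r * (SemidirectProduct.inl x⁻¹ *
          SemidirectProduct.inr s) := by
        ext <;> simp [r, hq.1]
      rw [this]
      exact mul_mem hrE hdE
    have := (QuotientGroup.eq_one_iff (N := E) q).2 hqE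
    change QuotientGroup.mk' E q = 1 at this
    rw [map_list_prod, List.map_map] at this
    exact this
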